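/- Let $[N]=\{1,\dots,N\}$, and let $\log$ denote the natural logarithm. A finite set $A$ of positive integers is called LCM-$3$-free if it does not contain three distinct elements $a_1,a_2,a_3$ with $$\operatorname{lcm}(a_1,a_2)=\operatorname{lcm}(a_1,a_3)=\operatorname{lcm}(a_2,a_3).$$ For $N\ge 1$ let $$f_3(N)=\max\Bigl\{\sum_{a\in A}\frac1a:\ A\subseteq[N]\text{ is LCM-}3\text{-free}\Bigr\}.$$ Then, as $N\to\infty$, $$(\log N)^{\log(1.551)-o(1)}\le f_3(N)\ll(\log N)^{\frac{3}{2^{2/3}}-1+o(1)}.$$ That is, there are functions $\varepsilon_1,\varepsilon_2:\mathbb N\to\mathbb R$ tending to $0$ as $N\to\infty$ and a constant $C>0$ such that, for all sufficiently large $N$, $$(\log N)^{\log(1.551)-\varepsilon_1(N)}\le f_3(N)\le C\,(\log N)^{\frac{3}{2^{2/3}}-1+\varepsilon_2(N)}.$$ -/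

import Mathlib

open Filter Topology Asymptotics

namespace EqualLCM

/-- `A` contains an LCM-`k`-tuple: there are distinct `a₁, …, a_k ∈ A` all of whose pairwise least
common multiples coincide. -/
def ContainsLCMTuple (k : ℕ) (A : Finset ℕ) : Prop :=
  ∃ a : Fin k → ℕ, Function.Injective a ∧ (∀ i, a i ∈ A) ∧
    ∃ m : ℕ, ∀ i j : Fin k, i < j → Nat.lcm (a i) (a j) = m

/-- `A` is LCM-`k`-free. -/
def LCMFree (k : ℕ) (A : Finset ℕ) : Prop :=
  ¬ ContainsLCMTuple k A

/-- The harmonic sums `∑_{a ∈ A} 1/a` of the LCM-`k`-free sets `A ⊆ {1, …, N}`. -/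
def harmonicSums (k N : ℕ) : Set ℝ :=
  {s : ℝ | ∃ A : Finset ℕ, A ⊆ Finset.Icc 1 N ∧ LCMFree k A ∧ s = ∑ a ∈ A, (1 : ℝ) / (a : ℝ)}

/-- `f_k(N)`, the largest harmonic sum of an LCM-`k`-free subset of `{1, …, N}`
(the supremum is a maximum, see `isGreatest_f`). -/
noncomputable def f (k N : ℕ) : ℝ :=
  sSup (harmonicSums k N)

/-- The supremum defining `f_k(N)` is attained. -/
theorem isGreatest_f {k : ℕ} (hk : 1 ≤ k) (N : ℕ) : IsGreatest (harmonicSums k N) (f k N) := by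
  have hne : (harmonicSums k N).Nonempty := by
    refine ⟨0, ∅, by simp, ?_, by simp⟩
    rintro ⟨a, -, ha, -⟩
    simpa using ha ⟨0, hk⟩
  have hfin : (harmonicSums k N).Finite := by
    refine (Set.Finite.image (s := ((Finset.Icc 1 N).powerset : Set (Finset ℕ)))
      (fun A => ∑ a ∈ A, (1 : ℝ) / (a : ℝ)) (Finset.finite_toSet _)).subset ?_
    rintro s ⟨A, hA, -, rfl⟩
    exact ⟨A, Finset.mem_coe.2 (Finset.mem_powerset.2 hA), rfl⟩
  exact ⟨hne.csSup_mem hfin, fun s hs => le_csSup hfin.bddAbove hs⟩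

end EqualLCM

/-! Squarefree integers correspond to sets of primes and lcm to union, so both bounds concern
families with no three distinct members whose pairwise unions all coincide.

Upper bound. Slice rank shows that a uniform family of this kind on `n` points has at most three
times as many members as there are sets of size at most `n / 3`, hence at most `3 * capacity ^ n`
(`card_le_three_mul_of_union_free`, `card_small_finsets_le`). So a squarefree LCM-free set `B`
contains few divisors of any `m`, in terms of the number ω(m) of primes dividing `m`. Multiplying
the harmonic sum of `B` by ∑ 1/b over b ≤ N counts these divisors with weight 1/m over m ≤ N², so
the product is at most a constant times ∑ D^ω(m)/m for any `D > capacity`. That sum is O((log N)^D)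
by an Euler product, and dividing by log N leaves the exponent `D - 1`. General sets reduce to
squarefree ones by writing a = s t² and fixing t.

Lower bound. Random parity tests over `ZMod 2` select each squarefree `a` with probability at least
2^(-ω(a)-2), and every outcome is LCM-free (`eq_of_union_eq_of_hashesToZero`,
`card_le_card_hashesToZero_mul`). Some outcome therefore has harmonic sum at least G/4, where G = ∑
2^(-ω(a))/a over squarefree a ≤ N. Expanding G² over factorizations gives log N ≤ 2G². Hence f is at
least a constant times (log N)^(1/2), which beats the required exponent, as log 1.551 < 1/2. -/

/-! ### Slice rank of diagonal tensors. -/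

/-- Take `h` of maximal support. Were the support smaller than the dimension, a nonzero `w` in `W`
would vanish on it, and `h + w` would have larger support. -/
lemma Submodule.exists_mem_finrank_le_card_support {X : Type*} [Fintype X] [DecidableEq X]
    (W : Submodule ℚ (X → ℚ)) :
    ∃ h ∈ W, Module.finrank ℚ W ≤ Fintype.card {x // h x ≠ 0} := by
  classical
  let supp : (X → ℚ) → Finset X := fun h => Finset.univ.filter fun x => h x ≠ 0
  obtain ⟨h, hW, hmax⟩ : ∃ h ∈ W, ∀ h' ∈ W, (supp h').card ≤ (supp h).card := by
    have hb : BddAbove ((fun h => (supp h).card) '' (W : Set (X → ℚ))) :=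
      ⟨Fintype.card X, by rintro _ ⟨h, _, rfl⟩; exact Finset.card_le_univ _⟩
    have hne : ((fun h => (supp h).card) '' (W : Set (X → ℚ))).Nonempty :=
      ⟨_, 0, W.zero_mem, rfl⟩
    obtain ⟨h, hW, hh⟩ := Nat.sSup_mem hne hb
    exact ⟨h, hW, fun h' hW' => (le_csSup hb ⟨h', hW', rfl⟩).trans hh.ge⟩
  refine ⟨h, hW, ?_⟩
  by_contra! hlt
  let φ : W →ₗ[ℚ] ({x // h x ≠ 0} → ℚ) :=
    (LinearMap.funLeft ℚ ℚ (Subtype.val : {x // h x ≠ 0} → X)).comp W.subtype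
  have hφ : ¬ Function.Injective φ := fun hinj => by
    have := LinearMap.finrank_le_finrank_of_injective hinj
    rw [Module.finrank_fintype_fun_eq_card] at this
    omega
  rw [← LinearMap.ker_eq_bot, Submodule.eq_bot_iff] at hφ
  push Not at hφ
  obtain ⟨w, hw, hw0⟩ := hφ
  have hvan : ∀ x, h x ≠ 0 → (w : X → ℚ) x = 0 := fun x hx => by
    have := congrFun (LinearMap.mem_ker.mp hw) ⟨x, hx⟩
    simpa [φ, LinearMap.funLeft] using this
  obtain ⟨x, hx⟩ : ∃ x, (w : X → ℚ) x ≠ 0 := by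
    by_contra! hc
    exact hw0 (Subtype.ext (funext hc))
  have hlt' : (supp h).card < (supp (h + w)).card := by
    apply Finset.card_lt_card
    rw [Finset.ssubset_iff_of_subset]
    · refine ⟨x, ?_, ?_⟩ <;>
      · have : h x = 0 := by by_contra hc; exact hx (hvan x hc)
        simp [supp, this, hx]
    · intro y hy
      have hy' : h y ≠ 0 := by simpa [supp] using hy
      simp [supp, hvan y hy', hy']
  exact absurd (hmax _ (W.add_mem hW w.2)) (by omega)

/-- Contract the third variable against a vector `h` orthogonal to every `f₃ k`, with support at
least `card X - card K`. The `K`-slices disappear; what remains is a diagonal matrix whose rank is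
the support of `h`, factored through `I ⊕ J`. -/
theorem card_le_of_diagonal_eq_sum_slices {X I J K : Type*} [Fintype X] [DecidableEq X]
    [Fintype I] [Fintype J] [Fintype K] (T : X → X → X → ℚ)
    (f₁ : I → X → ℚ) (g₁ : I → X → X → ℚ) (f₂ : J → X → ℚ) (g₂ : J → X → X → ℚ)
    (f₃ : K → X → ℚ) (g₃ : K → X → X → ℚ)
    (hT : ∀ x y z, T x y z = ∑ i, f₁ i x * g₁ i y z + ∑ j, f₂ j y * g₂ j x z
      + ∑ k, f₃ k z * g₃ k x y)
    (hoff : ∀ x y z, ¬ (x = y ∧ y = z) → T x y z = 0) (hdiag : ∀ x, T x x x ≠ 0) :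
    Fintype.card X ≤ Fintype.card I + Fintype.card J + Fintype.card K := by
  classical
  let L : (X → ℚ) →ₗ[ℚ] (K → ℚ) := (Matrix.of fun k z => f₃ k z : Matrix K X ℚ).mulVecLin
  obtain ⟨h, hW, hcard⟩ := Submodule.exists_mem_finrank_le_card_support (LinearMap.ker L)
  have hrank : Fintype.card X ≤ Fintype.card K + Module.finrank ℚ (LinearMap.ker L) := by
    have h1 := LinearMap.finrank_range_add_finrank_ker L
    have h2 : Module.finrank ℚ (LinearMap.range L) ≤ Fintype.card K := by
      simpa using Submodule.finrank_le (LinearMap.range L)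
    rw [Module.finrank_fintype_fun_eq_card] at h1
    omega
  have hf₃ : ∀ k, ∑ z, h z * f₃ k z = 0 := fun k => by
    have := congrFun (LinearMap.mem_ker.mp hW) k
    simpa [L, Matrix.mulVec, dotProduct, mul_comm] using this
  have hM : Matrix.diagonal (fun x => h x * T x x x) =
      (Matrix.of fun x (s : I ⊕ J) => Sum.elim (fun i => f₁ i x)
        (fun j => ∑ z, h z * g₂ j x z) s) *
      (Matrix.of fun (s : I ⊕ J) y => Sum.elim (fun i => ∑ z, h z * g₁ i y z)
        (fun j => f₂ j y) s) := by
    ext x y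
    have h1 : Matrix.diagonal (fun x => h x * T x x x) x y = ∑ z, h z * T x y z := by
      by_cases hxy : x = y
      · subst hxy
        rw [Matrix.diagonal_apply_eq, Finset.sum_eq_single x]
        · intro z _ hz
          rw [hoff x x z (fun hc => hz hc.2.symm), mul_zero]
        · simp
      · rw [Matrix.diagonal_apply_ne _ hxy]
        exact (Finset.sum_eq_zero fun z _ => by
          rw [hoff x y z (fun hc => hxy hc.1), mul_zero]).symm
    have h3 : ∑ z, h z * ∑ k, f₃ k z * g₃ k x y = 0 := by
      simp_rw [Finset.mul_sum, ← mul_assoc]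
      rw [Finset.sum_comm]
      refine Finset.sum_eq_zero fun k _ => ?_
      rw [← Finset.sum_mul, hf₃, zero_mul]
    rw [h1, Matrix.mul_apply, Fintype.sum_sum_type]
    simp_rw [hT, mul_add, Finset.sum_add_distrib]
    rw [h3, add_zero]
    simp only [Matrix.of_apply, Sum.elim_inl, Sum.elim_inr, Finset.mul_sum, Finset.sum_mul]
    rw [Finset.sum_comm]
    congr 1
    · exact Finset.sum_congr rfl fun _ _ => Finset.sum_congr rfl fun _ _ => by ring
    · rw [Finset.sum_comm]
      exact Finset.sum_congr rfl fun _ _ => Finset.sum_congr rfl fun _ _ => by ring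
  have hle : Fintype.card {x // h x ≠ 0} ≤ Fintype.card I + Fintype.card J := by
    have h1 := Matrix.rank_diagonal (fun x => h x * T x x x)
    rw [hM] at h1
    have h2 := (Matrix.rank_mul_le_left (Matrix.of fun x (s : I ⊕ J) =>
      Sum.elim (fun i => f₁ i x) (fun j => ∑ z, h z * g₂ j x z) s)
      (Matrix.of fun (s : I ⊕ J) y => Sum.elim (fun i => ∑ z, h z * g₁ i y z)
        (fun j => f₂ j y) s)).trans (Matrix.rank_le_card_width _)
    rw [h1, Fintype.card_sum] at h2
    refine le_trans (le_of_eq ?_) h2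
    exact Fintype.card_congr (Equiv.subtypeEquivRight fun x => by simp [hdiag x])
  omega

/-! ### Uniform families without three equal pairwise unions. -/

section
variable {ι : Type*} [Fintype ι] [DecidableEq ι]

/-- The sign-twisted indicator of `S ⊆ A`. -/
def signedSubsetIndicator (S A : Finset ι) : ℚ :=
  ∏ i, if i ∈ S then (if i ∈ A then -1 else 0) else 1

/-- The tensor `∏ᵢ (1 - 1_A(i) - 1_B(i) - 1_C(i))`. -/
def lonelyTensor (A B C : Finset ι) : ℚ :=
  ∏ i, (1 + (if i ∈ A then -1 else 0) + (if i ∈ B then -1 else 0) + (if i ∈ C then -1 else 0))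

/-- The positions at which `τ` takes the value `s`. -/
def colorClass (τ : ι → Fin 4) (s : Fin 4) : Finset ι := Finset.univ.filter fun i => τ i = s

lemma lonelyTensor_eq_sum (A B C : Finset ι) :
    lonelyTensor A B C = ∑ τ : ι → Fin 4, signedSubsetIndicator (colorClass τ 1) A *
      signedSubsetIndicator (colorClass τ 2) B * signedSubsetIndicator (colorClass τ 3) C := by
  let u : ι → Fin 4 → ℚ := fun i => ![1, if i ∈ A then -1 else 0, if i ∈ B then -1 else 0,
    if i ∈ C then -1 else 0]
  have h1 : lonelyTensor A B C = ∏ i, ∑ s, u i s := by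
    unfold lonelyTensor
    refine Finset.prod_congr rfl fun i _ => ?_
    simp [u, Fin.sum_univ_four]
  rw [h1, Finset.prod_univ_sum, Fintype.piFinset_univ]
  refine Finset.sum_congr rfl fun τ _ => ?_
  unfold signedSubsetIndicator
  rw [← Finset.prod_mul_distrib, ← Finset.prod_mul_distrib]
  refine Finset.prod_congr rfl fun i _ => ?_
  simp only [colorClass, Finset.mem_filter, Finset.mem_univ, true_and]
  generalize τ i = s
  fin_cases s <;> simp [u]

lemma three_mul_card_colorClass_le (τ : ι → Fin 4) (h1 : ¬ 3 * (colorClass τ 1).card ≤ Fintype.card ι)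
    (h2 : ¬ 3 * (colorClass τ 2).card ≤ Fintype.card ι) :
    3 * (colorClass τ 3).card ≤ Fintype.card ι := by
  have hd : (colorClass τ 1).card + (colorClass τ 2).card + (colorClass τ 3).card ≤
      Fintype.card ι := by
    rw [← Finset.card_union_of_disjoint, ← Finset.card_union_of_disjoint]
    · exact Finset.card_le_univ _
    · rw [Finset.disjoint_left]
      intro i; simp only [colorClass, Finset.mem_union, Finset.mem_filter, Finset.mem_univ, true_and]
      rintro (h | h) <;> simp [h]
    · rw [Finset.disjoint_left]
      intro i; simp only [colorClass, Finset.mem_filter, Finset.mem_univ, true_and]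
      intro h; simp [h]
  omega

/-- `lonelyTensor` vanishes as soon as some point lies in exactly one of the three sets. If no point
does, all pairwise unions agree, so on `F` the tensor is diagonal, with diagonal factors 1 and -2.
In each monomial of its expansion one of the three disjoint colour classes has at most a third of
the points, which bounds the number of slices. -/
theorem card_le_three_mul_of_union_free (F : Finset (Finset ι)) (k : ℕ)
    (hk : ∀ A ∈ F, A.card = k)
    (hF : ∀ A ∈ F, ∀ B ∈ F, ∀ C ∈ F, A ≠ B → A ≠ C → B ≠ C →
      ¬ (A ∪ B = A ∪ C ∧ A ∪ B = B ∪ C)) :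
    F.card ≤ 3 * (Finset.univ.filter fun S : Finset ι => 3 * S.card ≤ Fintype.card ι).card := by
  let small : Finset (Finset ι) := Finset.univ.filter fun S : Finset ι => 3 * S.card ≤ Fintype.card ι
  have hzero : ∀ A B C : Finset ι, ∀ i, (i ∈ A ∧ i ∉ B ∧ i ∉ C) ∨ (i ∉ A ∧ i ∈ B ∧ i ∉ C) ∨
      (i ∉ A ∧ i ∉ B ∧ i ∈ C) → lonelyTensor A B C = 0 := by
    intro A B C i hi
    refine Finset.prod_eq_zero (Finset.mem_univ i) ?_
    rcases hi with ⟨h1, h2, h3⟩ | ⟨h1, h2, h3⟩ | ⟨h1, h2, h3⟩ <;> simp [h1, h2, h3]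
  -- Uniformity enters here: it excludes inclusions, so triples with exactly two equal entries also
  -- have a point in only one set.
  have hne : ∀ A ∈ F, ∀ B ∈ F, A ≠ B → ∃ i ∈ B, i ∉ A := by
    intro A hA B hB hAB
    by_contra! hc
    exact hAB (Finset.eq_of_subset_of_card_le hc (by rw [hk A hA, hk B hB])).symm
  -- Each colouring is charged to the first of its three classes that is small, so that no monomial
  -- is counted twice.
  have key := card_le_of_diagonal_eq_sum_slices (X := F) (I := small) (J := small) (K := small)
    (fun A B C => lonelyTensor A.1 B.1 C.1)
    (fun S A => signedSubsetIndicator S.1 A.1)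
    (fun S B C => ∑ τ : ι → Fin 4 with colorClass τ 1 = S.1,
      signedSubsetIndicator (colorClass τ 2) B.1 * signedSubsetIndicator (colorClass τ 3) C.1)
    (fun S A => signedSubsetIndicator S.1 A.1)
    (fun S A C => ∑ τ : ι → Fin 4 with colorClass τ 1 ∉ small ∧ colorClass τ 2 = S.1,
      signedSubsetIndicator (colorClass τ 1) A.1 * signedSubsetIndicator (colorClass τ 3) C.1)
    (fun S A => signedSubsetIndicator S.1 A.1)
    (fun S A B => ∑ τ : ι → Fin 4 with
      (colorClass τ 1 ∉ small ∧ colorClass τ 2 ∉ small) ∧ colorClass τ 3 = S.1,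
      signedSubsetIndicator (colorClass τ 1) A.1 * signedSubsetIndicator (colorClass τ 2) B.1)
    ?_ ?_ ?_
  · simp only [Fintype.card_coe] at key
    change F.card ≤ 3 * small.card
    omega
  · rintro ⟨A, -⟩ ⟨B, -⟩ ⟨C, -⟩
    simp only
    rw [lonelyTensor_eq_sum]
    have fib : ∀ (p : (ι → Fin 4) → Prop) [DecidablePred p] (s : Fin 4) (G : (ι → Fin 4) → ℚ),
        ∑ τ with p τ ∧ colorClass τ s ∈ small, G τ =
        ∑ S : small, ∑ τ with p τ ∧ colorClass τ s = S.1, G τ := by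
      intro p _ s G
      rw [Finset.sum_coe_sort small
        (fun S => ∑ τ with p τ ∧ colorClass τ s = S, G τ)]
      rw [← Finset.sum_fiberwise_of_maps_to (s := Finset.univ.filter fun τ => p τ ∧ colorClass τ s ∈ small)
        (t := small) (g := fun τ => colorClass τ s) (by simp)]
      refine Finset.sum_congr rfl fun S hS => Finset.sum_congr ?_ fun _ _ => rfl
      ext τ
      simp only [Finset.mem_filter, Finset.mem_univ, true_and]
      constructor
      · rintro ⟨⟨h1, -⟩, h2⟩; exact ⟨h1, h2⟩
      · rintro ⟨h1, h2⟩; exact ⟨⟨h1, h2 ▸ hS⟩, h2⟩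
    have hsmall : ∀ τ : ι → Fin 4, colorClass τ 1 ∉ small → colorClass τ 2 ∉ small →
        colorClass τ 3 ∈ small := by
      intro τ
      simpa [small] using three_mul_card_colorClass_le τ
    let G : (ι → Fin 4) → ℚ := fun τ => signedSubsetIndicator (colorClass τ 1) A *
      signedSubsetIndicator (colorClass τ 2) B * signedSubsetIndicator (colorClass τ 3) C
    have e1 : ∑ τ, G τ = ∑ τ with True ∧ colorClass τ 1 ∈ small, G τ +
        ∑ τ with colorClass τ 1 ∉ small ∧ colorClass τ 2 ∈ small, G τ +
        ∑ τ with (colorClass τ 1 ∉ small ∧ colorClass τ 2 ∉ small) ∧ colorClass τ 3 ∈ small,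
          G τ := by
      rw [← Finset.sum_filter_add_sum_filter_not Finset.univ (fun τ => colorClass τ 1 ∈ small),
        ← Finset.sum_filter_add_sum_filter_not
          (Finset.univ.filter fun τ : ι → Fin 4 => colorClass τ 1 ∉ small)
          (fun τ => colorClass τ 2 ∈ small), Finset.filter_filter, Finset.filter_filter, add_assoc]
      simp only [true_and]
      congr 2
      refine Finset.sum_congr ?_ fun _ _ => rfl
      ext τ
      simp only [Finset.mem_filter, Finset.mem_univ, true_and]
      exact ⟨fun h => ⟨h, hsmall τ h.1 h.2⟩, fun h => h.1⟩
    change ∑ τ, G τ = _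
    rw [e1, fib, fib, fib]
    refine congrArg₂ _ (congrArg₂ _ ?_ ?_) ?_ <;>
    · refine Finset.sum_congr rfl fun S _ => ?_
      rw [Finset.mul_sum]
      try simp only [true_and]
      refine Finset.sum_congr rfl fun τ hτ => ?_
      simp only [Finset.mem_filter, Finset.mem_univ, true_and] at hτ
      first
        | rw [← hτ]; simp only [G]; ring
        | rw [← hτ.2]; simp only [G]; ring
  · rintro ⟨A, hA⟩ ⟨B, hB⟩ ⟨C, hC⟩ hne3
    simp only [Subtype.mk.injEq] at hne3
    by_cases hAB : A = B
    · subst hAB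
      obtain ⟨i, hi, hi'⟩ := hne A hA C hC (fun h => hne3 ⟨rfl, h⟩)
      exact hzero _ _ _ i (by tauto)
    by_cases hAC : A = C
    · subst hAC
      obtain ⟨i, hi, hi'⟩ := hne A hA B hB hAB
      exact hzero _ _ _ i (by tauto)
    by_cases hBC : B = C
    · subst hBC
      obtain ⟨i, hi, hi'⟩ := hne B hB A hA (Ne.symm hAB)
      exact hzero _ _ _ i (by tauto)
    by_contra hT
    apply hF A hA B hB C hC hAB hAC hBC
    have hno : ∀ i, ¬ ((i ∈ A ∧ i ∉ B ∧ i ∉ C) ∨ (i ∉ A ∧ i ∈ B ∧ i ∉ C) ∨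
      (i ∉ A ∧ i ∉ B ∧ i ∈ C)) := fun i hi => hT (hzero A B C i hi)
    constructor <;>
    · ext i
      have := hno i
      simp only [Finset.mem_union]
      tauto
  · rintro ⟨A, -⟩
    refine Finset.prod_ne_zero_iff.mpr fun i _ => ?_
    by_cases h : i ∈ A <;> simp [h]

end

/-! ### Mean values of `c ^ ω(m)` by Euler products. -/

lemma sum_Icc_rpow_le {h : ℝ} (hh : 0 < h) (M : ℕ) :
    ∑ n ∈ Finset.Icc 1 M, (n : ℝ) ^ (-(1 + h)) ≤ 1 + 1 / h := by
  -- The exact integral of x^(-1-h) over [1, M+1] is kept, so that the induction closes.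
  suffices H : ∀ M : ℕ, ∑ n ∈ Finset.Icc 1 (M + 1), (n : ℝ) ^ (-(1 + h)) ≤
      1 + (1 - ((M + 1 : ℕ) : ℝ) ^ (-h)) / h by
    rcases M with _ | M
    · simp; positivity
    · refine (H M).trans ?_
      gcongr
      have : (0 : ℝ) ≤ ((M + 1 : ℕ) : ℝ) ^ (-h) := by positivity
      linarith
  intro M
  induction M with
  | zero => simp
  | succ M ih =>
    rw [Finset.sum_Icc_succ_top (by omega)]
    refine (add_le_add_left ih _).trans ?_
    set n : ℝ := ((M + 1 + 1 : ℕ) : ℝ) with hn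
    have hM : ((M + 1 : ℕ) : ℝ) = n * (1 - 1 / n) := by
      rw [hn]; push_cast; field_simp; ring
    have hn2 : 2 ≤ n := by rw [hn]; push_cast; linarith [(M.cast_nonneg : (0 : ℝ) ≤ M)]
    have hn0 : 0 < n := by linarith
    have ht : 1 / n ≤ 1 / 2 := one_div_le_one_div_of_le two_pos hn2
    have ht0 : 0 < 1 - 1 / n := by linarith
    have key : 1 + h * (1 / n) ≤ (1 - 1 / n) ^ (-h) := by
      have h1 : (1 - 1 / n) ≤ Real.exp (-(1 / n)) := by
        have := Real.add_one_le_exp (-(1 / n)); linarith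
      calc 1 + h * (1 / n) ≤ Real.exp (h * (1 / n)) := by
            have := Real.add_one_le_exp (h * (1 / n)); linarith
        _ = Real.exp (-(1 / n)) ^ (-h) := by rw [← Real.exp_mul]; ring_nf
        _ ≤ _ := Real.rpow_le_rpow_of_nonpos ht0 h1 (by linarith)
    rw [hM, Real.mul_rpow hn0.le ht0.le, neg_add, add_comm (-1 : ℝ), Real.rpow_add hn0,
      Real.rpow_neg_one]
    have hp : 0 < n ^ (-h) := by positivity
    have h2 := mul_le_mul_of_nonneg_left key hp.le
    have h3 : n ^ (-h) * n⁻¹ = (n ^ (-h) * (h * (1 / n))) / h := by field_simp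
    rw [h3, add_assoc, ← add_div]
    gcongr
    linarith

lemma prod_primesBelow_one_sub_rpow_inv_le {h : ℝ} (hh : 0 < h) (N : ℕ) :
    ∏ p ∈ N.primesBelow, (1 - (p : ℝ) ^ (-(1 + h)))⁻¹ ≤ 1 + 1 / h := by
  let φ : ℕ →* ℝ :=
    { toFun := fun n => (n : ℝ) ^ (-(1 + h))
      map_one' := by simp
      map_mul' := fun a b => by
        push_cast; exact Real.mul_rpow (by positivity) (by positivity) }
  have hsum : Summable φ := Real.summable_nat_rpow.mpr (by linarith)
  have h1 := EulerProduct.prod_primesBelow_geometric_eq_tsum_smoothNumbers hsum N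
  change ∏ p ∈ N.primesBelow, (1 - φ p)⁻¹ ≤ _
  rw [h1]
  refine (hsum.tsum_subtype_le φ _ (fun n => by change 0 ≤ (n : ℝ) ^ (-(1 + h)); positivity)).trans ?_
  refine Real.tsum_le_of_sum_range_le (fun n => by change 0 ≤ (n : ℝ) ^ (-(1 + h)); positivity)
    fun n => ?_
  refine le_trans ?_ (sum_Icc_rpow_le hh n)
  rw [← Finset.sum_filter_ne_zero]
  refine Finset.sum_le_sum_of_subset_of_nonneg (fun m hm => ?_) fun m _ _ =>
    Real.rpow_nonneg m.cast_nonneg _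
  rw [Finset.mem_filter, Finset.mem_range] at hm
  obtain ⟨hm, hm0⟩ := hm
  rcases Nat.eq_zero_or_pos m with rfl | hpos
  · refine absurd ?_ hm0
    change ((0 : ℕ) : ℝ) ^ (-(1 + h)) = 0
    rw [Nat.cast_zero, Real.zero_rpow (by linarith)]
  · rw [Finset.mem_Icc]; omega

/-- Compares the Euler factor of `c ^ ω(m)` with the `c`-th power of the zeta factor. It follows
from Bernoulli's inequality for the exponent `c - 1` in [0, 1], which is where `c ≤ 2` is needed. -/
lemma one_add_sub_one_mul_le_rpow {c y : ℝ} (hc1 : 1 ≤ c) (hc2 : c ≤ 2) (hy0 : 0 ≤ y) (hy1 : y < 1) :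
    c * (1 - y)⁻¹ + (1 - c) ≤ ((1 - y)⁻¹) ^ c := by
  have h1 : 0 < 1 - y := by linarith
  have hb : (1 - y) ^ (c - 1) ≤ 1 - (c - 1) * y := by
    have := rpow_one_add_le_one_add_mul_self (s := -y) (by linarith) (p := c - 1)
      (by linarith) (by linarith)
    calc (1 - y) ^ (c - 1) = (1 + -y) ^ (c - 1) := by ring_nf
      _ ≤ _ := this
      _ = _ := by ring
  have hp : 0 < (1 - y) ^ (c - 1) := by positivity
  have h2 : (1 + (c - 1) * y) * (1 - y) ^ (c - 1) ≤ 1 := by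
    have : 0 ≤ (c - 1) * y := mul_nonneg (by linarith) hy0
    calc (1 + (c - 1) * y) * (1 - y) ^ (c - 1) ≤ (1 + (c - 1) * y) * (1 - (c - 1) * y) := by
          gcongr
      _ ≤ 1 := by nlinarith
  have h3 : ((1 - y)⁻¹) ^ c = ((1 - y) ^ (c - 1))⁻¹ * (1 - y)⁻¹ := by
    rw [← mul_inv, Real.inv_rpow h1.le]
    congr 1
    nth_rewrite 3 [← Real.rpow_one (1 - y)]
    rw [← Real.rpow_add h1]; ring_nf
  have h4 : c * (1 - y)⁻¹ + (1 - c) = (1 + (c - 1) * y) * (1 - y)⁻¹ := by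
    field_simp; ring
  rw [h3, h4]
  gcongr
  rw [← one_div, le_div_iff₀ hp]
  exact h2

theorem sum_pow_card_primeFactors_mul_rpow_le {c h : ℝ} (hc1 : 1 ≤ c) (hc2 : c ≤ 2) (hh : 0 < h)
    (M : ℕ) :
    ∑ m ∈ Finset.Icc 1 M, c ^ m.primeFactors.card * (m : ℝ) ^ (-(1 + h)) ≤ (1 + 1 / h) ^ c := by
  let F : ℕ → ℝ := fun m => c ^ m.primeFactors.card * (m : ℝ) ^ (-(1 + h))
  have hF0 : ∀ m, 0 ≤ F m := fun m => by positivity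
  have hF1 : F 1 = 1 := by simp [F]
  have hFmul : ∀ {m n : ℕ}, Nat.Coprime m n → F (m * n) = F m * F n := by
    intro m n hmn
    simp only [F]
    rw [hmn.primeFactors_mul, Finset.card_union_of_disjoint hmn.disjoint_primeFactors, pow_add,
      Nat.cast_mul, Real.mul_rpow (by positivity) (by positivity)]
    ring
  have hy : ∀ {p : ℕ}, p.Prime → 0 ≤ (p : ℝ) ^ (-(1 + h)) ∧ (p : ℝ) ^ (-(1 + h)) < 1 := by
    intro p hp
    exact ⟨by positivity, Real.rpow_lt_one_of_one_lt_of_neg (by exact_mod_cast hp.one_lt)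
      (by linarith)⟩
  have hHas : ∀ {p : ℕ}, p.Prime → HasSum (fun n : ℕ => F (p ^ n))
      (c * (1 - (p : ℝ) ^ (-(1 + h)))⁻¹ + (1 - c)) := by
    intro p hp
    have h1 := (hasSum_geometric_of_lt_one (hy hp).1 (hy hp).2).mul_left c
    have h2 := h1.add (hasSum_ite_eq (0 : ℕ) (1 - c))
    refine h2.congr_fun fun n => ?_
    rcases n with _ | n
    · simp [F]
    · simp only [F, Nat.primeFactors_prime_pow (Nat.succ_ne_zero n) hp, Finset.card_singleton,
        pow_one, if_neg (Nat.succ_ne_zero n), add_zero, Nat.cast_pow]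
      rw [← Real.rpow_natCast, ← Real.rpow_natCast, ← Real.rpow_mul (by positivity),
        ← Real.rpow_mul (by positivity)]
      ring_nf
  have hprod := EulerProduct.summable_and_hasSum_smoothNumbers_prod_primesBelow_tsum hF1 hFmul
    (fun {p} hp => by simpa using (hHas hp).summable.norm) (M + 1)
  have hle : ∑ m ∈ Finset.Icc 1 M, F m ≤
      ∏ p ∈ (M + 1).primesBelow, ∑' n : ℕ, F (p ^ n) := by
    have hmem : ∀ m ∈ Finset.Icc 1 M, m ∈ (M + 1).smoothNumbers := fun m hm => by
      rw [Finset.mem_Icc] at hm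
      exact Nat.mem_smoothNumbers_of_lt (by omega) (by omega)
    have := sum_le_hasSum (Finset.subtype (· ∈ (M + 1).smoothNumbers) (Finset.Icc 1 M))
      (fun m _ => hF0 m) hprod.2
    rwa [Finset.sum_subtype_of_mem F hmem] at this
  refine hle.trans ?_
  calc ∏ p ∈ (M + 1).primesBelow, ∑' n : ℕ, F (p ^ n)
      ≤ ∏ p ∈ (M + 1).primesBelow, ((1 - (p : ℝ) ^ (-(1 + h)))⁻¹) ^ c := by
        refine Finset.prod_le_prod (fun p _ => tsum_nonneg fun n => hF0 _) fun p hp => ?_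
        have hp' := Nat.prime_of_mem_primesBelow hp
        rw [(hHas hp').tsum_eq]
        exact one_add_sub_one_mul_le_rpow hc1 hc2 (hy hp').1 (hy hp').2
    _ = (∏ p ∈ (M + 1).primesBelow, (1 - (p : ℝ) ^ (-(1 + h)))⁻¹) ^ c := by
        refine Real.finsetProd_rpow _ _ (fun p hp => ?_) _
        have := (hy (Nat.prime_of_mem_primesBelow hp)).2
        exact inv_nonneg.mpr (by linarith)
    _ ≤ _ := by
        refine Real.rpow_le_rpow (Finset.prod_nonneg fun p hp => ?_)
          (prod_primesBelow_one_sub_rpow_inv_le hh _) (by linarith)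
        have := (hy (Nat.prime_of_mem_primesBelow hp)).2
        exact inv_nonneg.mpr (by linarith)

/-- Rankin's trick with `h = 1 / log M`: for `m ≤ M` the factor `m ^ h` is at most e. -/
theorem sum_pow_card_primeFactors_div_le {c : ℝ} (hc1 : 1 ≤ c) (hc2 : c ≤ 2) {M : ℕ} (hM : 2 ≤ M) :
    ∑ m ∈ Finset.Icc 1 M, c ^ m.primeFactors.card / (m : ℝ) ≤
      Real.exp 1 * (1 + Real.log M) ^ c := by
  have hlog : 0 < Real.log M := Real.log_pos (by exact_mod_cast hM)
  have h1 := sum_pow_card_primeFactors_mul_rpow_le hc1 hc2 (one_div_pos.mpr hlog) M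
  rw [one_div_one_div] at h1
  refine le_trans ?_ (mul_le_mul_of_nonneg_left h1 (Real.exp_pos 1).le)
  rw [Finset.mul_sum]
  refine Finset.sum_le_sum fun m hm => ?_
  rw [Finset.mem_Icc] at hm
  have hm0 : (0 : ℝ) < m := by exact_mod_cast hm.1
  have h2 : (m : ℝ) ^ (1 / Real.log M) ≤ Real.exp 1 := by
    rw [Real.rpow_def_of_pos hm0]
    refine Real.exp_le_exp.mpr ?_
    rw [mul_one_div, div_le_one hlog]
    exact Real.log_le_log hm0 (by exact_mod_cast hm.2)
  have h3 : (m : ℝ) ^ (-(1 + 1 / Real.log M)) = (m : ℝ)⁻¹ * ((m : ℝ) ^ (1 / Real.log M))⁻¹ := by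
    rw [Real.rpow_neg hm0.le, Real.rpow_add hm0, Real.rpow_one, mul_inv]
  rw [h3]
  have h4 : 1 ≤ Real.exp 1 * ((m : ℝ) ^ (1 / Real.log M))⁻¹ := by
    rw [← div_eq_mul_inv, one_le_div (by positivity)]
    exact h2
  have h5 : 0 ≤ c ^ m.primeFactors.card * (m : ℝ)⁻¹ := by positivity
  calc c ^ m.primeFactors.card / (m : ℝ) = c ^ m.primeFactors.card * (m : ℝ)⁻¹ * 1 := by
        rw [mul_one, div_eq_mul_inv]
    _ ≤ c ^ m.primeFactors.card * (m : ℝ)⁻¹ * (Real.exp 1 * ((m : ℝ) ^ (1 / Real.log M))⁻¹) := by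
        gcongr
    _ = _ := by ring

/-! ### Squarefree integers as sets of primes, and divisor counts in LCM-free sets. -/

lemma Nat.dvd_of_primeFactors_subset {b n : ℕ}  (hb : Squarefree b)
    (h : b.primeFactors ⊆ n.primeFactors) : b ∣ n := by
  rw [← Nat.prod_primeFactors_of_squarefree hb]
  exact (Finset.prod_dvd_prod_of_subset _ _ _ h).trans (Nat.prod_primeFactors_dvd n)

lemma Nat.lcm_dvd_lcm_of_primeFactors_subset {a b c d : ℕ} (ha : Squarefree a) (hb : Squarefree b)
    (hc : Squarefree c) (hd : Squarefree d)
    (h : a.primeFactors ∪ b.primeFactors ⊆ c.primeFactors ∪ d.primeFactors) :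
    Nat.lcm a b ∣ Nat.lcm c d := by
  have h0 : Nat.lcm c d ≠ 0 := Nat.lcm_ne_zero hc.ne_zero hd.ne_zero
  have h1 : c.primeFactors ∪ d.primeFactors ⊆ (Nat.lcm c d).primeFactors :=
    Finset.union_subset (Nat.primeFactors_mono (Nat.dvd_lcm_left c d) h0)
      (Nat.primeFactors_mono (Nat.dvd_lcm_right c d) h0)
  replace h := h.trans h1
  exact Nat.lcm_dvd (Nat.dvd_of_primeFactors_subset ha (Finset.union_subset_left h))
    (Nat.dvd_of_primeFactors_subset hb (Finset.union_subset_right h))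

lemma Nat.lcm_eq_lcm_of_primeFactors {a b c d : ℕ} (ha : Squarefree a) (hb : Squarefree b)
    (hc : Squarefree c) (hd : Squarefree d)
    (h : a.primeFactors ∪ b.primeFactors = c.primeFactors ∪ d.primeFactors) :
    Nat.lcm a b = Nat.lcm c d :=
  Nat.dvd_antisymm (Nat.lcm_dvd_lcm_of_primeFactors_subset ha hb hc hd h.le)
    (Nat.lcm_dvd_lcm_of_primeFactors_subset hc hd ha hb h.ge)

lemma Nat.eq_of_primeFactors_eq {a b : ℕ} (ha : Squarefree a) (hb : Squarefree b)
    (h : a.primeFactors = b.primeFactors) : a = b := by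
  rw [← Nat.prod_primeFactors_of_squarefree ha, h, Nat.prod_primeFactors_of_squarefree hb]

namespace EqualLCM

lemma lcmFree_three_iff (A : Finset ℕ) : LCMFree 3 A ↔
    ∀ a ∈ A, ∀ b ∈ A, ∀ c ∈ A, a ≠ b → a ≠ c → b ≠ c →
      ¬ (Nat.lcm a b = Nat.lcm a c ∧ Nat.lcm a b = Nat.lcm b c) := by
  constructor
  · rintro hA a ha b hb c hc hab hac hbc ⟨h1, h2⟩
    refine hA ⟨![a, b, c], ?_, ?_, Nat.lcm a b, ?_⟩
    · intro i j hij
      fin_cases i <;> fin_cases j <;> simp_all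
    · intro i
      fin_cases i <;> simp_all
    · intro i j hij
      fin_cases i <;> fin_cases j <;> simp_all
  · rintro h ⟨a, hinj, hmem, m, hm⟩
    refine h (a 0) (hmem 0) (a 1) (hmem 1) (a 2) (hmem 2) (hinj.ne (by decide))
      (hinj.ne (by decide)) (hinj.ne (by decide)) ⟨?_, ?_⟩
    · rw [hm 0 1 (by decide), hm 0 2 (by decide)]
    · rw [hm 0 1 (by decide), hm 1 2 (by decide)]

/-- The constant `3 / 2 ^ (2 / 3)`. -/
noncomputable def capacity : ℝ := 3 / (2 : ℝ) ^ ((2 : ℝ) / 3)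

lemma capacity_pos : 0 < capacity := by unfold capacity; positivity

lemma two_rpow_third_cube : ((2 : ℝ) ^ ((1 : ℝ) / 3)) ^ 3 = 2 := by
  rw [← Real.rpow_natCast, ← Real.rpow_mul two_pos.le]; norm_num

lemma capacity_eq : capacity = 3 / 2 * (2 : ℝ) ^ ((1 : ℝ) / 3) := by
  unfold capacity
  have h : (2 : ℝ) ^ ((2 : ℝ) / 3) * (2 : ℝ) ^ ((1 : ℝ) / 3) = 2 := by
    rw [← Real.rpow_add two_pos]; norm_num
  field_simp
  linarith

lemma one_lt_capacity : 1 < capacity := by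
  rw [capacity_eq]
  have : (1 : ℝ) ≤ (2 : ℝ) ^ ((1 : ℝ) / 3) := Real.one_le_rpow one_le_two (by norm_num)
  linarith

lemma capacity_lt_two : capacity < 2 := by
  rw [capacity_eq]
  have : (2 : ℝ) ^ ((1 : ℝ) / 3) < 4 / 3 := by
    refine lt_of_pow_lt_pow_left₀ 3 (by norm_num) ?_
    rw [two_rpow_third_cube]; norm_num
  linarith

/-- Chernoff-type weighting: with `r = 2 ^ (1/3)`, the weight `(1/2) ^ #S * r ^ n` is at least 1 on
sets with `3 * #S ≤ n`, and its total over all sets is `(3/2 * r) ^ n`. -/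
lemma card_small_finsets_le (ι : Type*) [Fintype ι] [DecidableEq ι] :
    ((Finset.univ.filter fun S : Finset ι => 3 * S.card ≤ Fintype.card ι).card : ℝ) ≤
      capacity ^ Fintype.card ι := by
  set n := Fintype.card ι
  set r : ℝ := (2 : ℝ) ^ ((1 : ℝ) / 3) with hr
  have hr1 : 1 ≤ r := Real.one_le_rpow one_le_two (by norm_num)
  have hsum : ∑ S : Finset ι, ((1 : ℝ) / 2) ^ S.card = (3 / 2) ^ n := by
    have := Finset.prod_one_add (f := fun _ : ι => (1 : ℝ) / 2) Finset.univ
    simp only [Finset.prod_const, Finset.powerset_univ, Finset.card_univ] at this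
    rw [← this]; norm_num [n]
  rw [capacity_eq, ← hr, mul_pow, ← hsum, Finset.sum_mul, Finset.card_eq_sum_ones, Nat.cast_sum]
  refine le_trans (Finset.sum_le_sum (g := fun S => (1 / 2 : ℝ) ^ S.card * r ^ n) fun S hS => ?_)
    (Finset.sum_le_sum_of_subset_of_nonneg (Finset.filter_subset _ _) fun _ _ _ => by positivity)
  rw [Finset.mem_filter] at hS
  calc ((1 : ℕ) : ℝ) = (1 / 2) ^ S.card * (r ^ 3) ^ S.card := by
        rw [hr, two_rpow_third_cube, ← mul_pow]; norm_num
    _ ≤ _ := by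
        rw [← pow_mul]
        gcongr
        exact hS.2

lemma card_divisors_fixed_card_le {A : Finset ℕ} (hA : LCMFree 3 A) (hsq : ∀ a ∈ A, Squarefree a)
    {m : ℕ} (hm : m ≠ 0) (k : ℕ) :
    ((A.filter fun s => s ∣ m ∧ s.primeFactors.card = k).card : ℝ) ≤
      3 * capacity ^ m.primeFactors.card := by
  rw [lcmFree_three_iff] at hA
  set B := A.filter fun s => s ∣ m ∧ s.primeFactors.card = k with hB
  have hBA : ∀ {s}, s ∈ B → s ∈ A ∧ s ∣ m ∧ s.primeFactors.card = k := fun hs => by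
    simpa [hB] using hs
  have hsub : ∀ {s}, s ∈ B → s.primeFactors ⊆ m.primeFactors := fun hs =>
    Nat.primeFactors_mono (hBA hs).2.1 hm
  let Φ : ℕ → Finset m.primeFactors := fun s => s.primeFactors.subtype (· ∈ m.primeFactors)
  have hmap : ∀ {s}, s ∈ B → (Φ s).map (Function.Embedding.subtype _) = s.primeFactors :=
    fun hs => Finset.subtype_map_of_mem (hsub hs)
  have hinj : Set.InjOn Φ B := fun a ha b hb hab => by
    refine Nat.eq_of_primeFactors_eq (hsq a (hBA ha).1) (hsq b (hBA hb).1) ?_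
    rw [← hmap ha, ← hmap hb, hab]
  have hun : ∀ {a b c d}, a ∈ B → b ∈ B → c ∈ B → d ∈ B → Φ a ∪ Φ b = Φ c ∪ Φ d →
      Nat.lcm a b = Nat.lcm c d := fun ha hb hc hd h => by
    refine Nat.lcm_eq_lcm_of_primeFactors (hsq _ (hBA ha).1) (hsq _ (hBA hb).1)
      (hsq _ (hBA hc).1) (hsq _ (hBA hd).1) ?_
    rw [← hmap ha, ← hmap hb, ← hmap hc, ← hmap hd, ← Finset.map_union, ← Finset.map_union, h]
  have key := card_le_three_mul_of_union_free (B.image Φ) k ?_ ?_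
  · rw [Finset.card_image_of_injOn hinj] at key
    have h2 := card_small_finsets_le m.primeFactors
    rw [Fintype.card_coe] at h2 key
    refine (Nat.cast_le.mpr key).trans ?_
    push_cast
    gcongr
  · simp only [Finset.mem_image]
    rintro _ ⟨a, ha, rfl⟩
    rw [← (hBA ha).2.2, ← hmap ha, Finset.card_map]
  · simp only [Finset.mem_image]
    rintro _ ⟨a, ha, rfl⟩ _ ⟨b, hb, rfl⟩ _ ⟨c, hc, rfl⟩ hab hac hbc ⟨h1, h2⟩
    exact hA a (hBA ha).1 b (hBA hb).1 c (hBA hc).1 (ne_of_apply_ne Φ hab) (ne_of_apply_ne Φ hac)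
      (ne_of_apply_ne Φ hbc) ⟨hun ha hb ha hc h1, hun ha hb hb hc h2⟩

lemma card_divisors_le {A : Finset ℕ} (hA : LCMFree 3 A) (hsq : ∀ a ∈ A, Squarefree a)
    {m : ℕ} (hm : m ≠ 0) :
    ((A.filter (· ∣ m)).card : ℝ) ≤
      3 * (m.primeFactors.card + 1) * capacity ^ m.primeFactors.card := by
  rw [Finset.card_eq_sum_card_fiberwise (f := fun s => s.primeFactors.card)
    (t := Finset.range (m.primeFactors.card + 1))]
  · push_cast
    refine (Finset.sum_le_card_nsmul _ _ (3 * capacity ^ m.primeFactors.card) fun k _ => ?_).trans ?_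
    · rw [Finset.filter_filter]
      exact card_divisors_fixed_card_le hA hsq hm k
    · rw [Finset.card_range, nsmul_eq_mul]; push_cast; apply le_of_eq; ring
  · intro s hs
    simp only [Finset.coe_filter, Set.mem_ofPred_eq] at hs
    simp only [Finset.coe_range, Set.mem_Iio]
    exact Nat.lt_succ_of_le (Finset.card_le_card (Nat.primeFactors_mono hs.2 hm))

/-- Absorbs the linear factor, which comes from splitting by the number of prime factors, into a
slightly larger base. -/
lemma exists_linear_mul_capacity_pow_le {D : ℝ} (hD : capacity < D) :
    ∃ K : ℝ, 0 < K ∧ ∀ k : ℕ, 3 * ((k : ℝ) + 1) * capacity ^ k ≤ K * D ^ k := by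
  have hC := capacity_pos
  have hD0 : 0 < D := hC.trans hD
  have hr0 : 0 ≤ capacity / D := by positivity
  have hr1 : capacity / D < 1 := (div_lt_one hD0).mpr hD
  have ht := (tendsto_self_mul_const_pow_of_lt_one hr0 hr1).add
    (tendsto_pow_atTop_nhds_zero_of_lt_one hr0 hr1)
  obtain ⟨K, hK⟩ := ht.bddAbove_range
  refine ⟨3 * max K 1, by positivity, fun k => ?_⟩
  have h1 := (hK ⟨k, rfl⟩).trans (le_max_left K 1)
  simp only [div_pow] at h1
  have hDk : 0 < D ^ k := by positivity
  have h2 : (k : ℝ) * (capacity ^ k / D ^ k) + capacity ^ k / D ^ k =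
      (k + 1) * capacity ^ k / D ^ k := by ring
  rw [h2, div_le_iff₀ hDk] at h1
  linarith

end EqualLCM

/-! ### Reduction to squarefree parts and the upper bound. -/

lemma sum_one_div_sq_le_two (M : ℕ) : ∑ t ∈ Finset.Icc 1 M, 1 / (t : ℝ) ^ 2 ≤ 2 := by
  have h := sum_Icc_rpow_le one_pos M
  refine le_trans (le_of_eq (Finset.sum_congr rfl fun t _ => ?_)) (h.trans (by norm_num))
  rw [show (-(1 + 1) : ℝ) = -((2 : ℕ) : ℝ) by norm_num, Real.rpow_neg t.cast_nonneg,
    Real.rpow_natCast, one_div]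

lemma log_le_sum_one_div (N : ℕ) : Real.log N ≤ ∑ b ∈ Finset.Icc 1 N, 1 / (b : ℝ) := by
  have h1 := log_add_one_le_harmonic N
  rw [harmonic_eq_sum_Icc] at h1
  push_cast at h1
  simp only [one_div]
  rcases Nat.eq_zero_or_pos N with rfl | hN
  · simp
  · exact (Real.log_le_log (by exact_mod_cast hN) (by linarith)).trans h1

lemma sum_one_div_le_of_squarefree_parts {A : Finset ℕ} {N : ℕ} (hA : A ⊆ Finset.Icc 1 N) {X : ℝ}
    (hX0 : 0 ≤ X)
    (hX : ∀ t : ℕ, t ≠ 0 →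
      ∑ s ∈ Finset.Icc 1 N with Squarefree s ∧ s * t ^ 2 ∈ A, 1 / (s : ℝ) ≤ X) :
    ∑ a ∈ A, 1 / (a : ℝ) ≤ 2 * X := by
  choose sq rt hmul hsq using Nat.sq_mul_squarefree
  have hA' : ∀ {a}, a ∈ A → 1 ≤ a ∧ a ≤ N := fun ha => Finset.mem_Icc.mp (hA ha)
  have hrt : ∀ {a}, a ∈ A → rt a ≠ 0 := fun {a} ha h0 => by
    have h1 := hmul a; have h2 := hA' ha; rw [h0] at h1; simp at h1; omega
  rw [← Finset.sum_fiberwise_of_maps_to (t := Finset.Icc 1 N) (g := rt)]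
  · calc ∑ t ∈ Finset.Icc 1 N, ∑ a ∈ A with rt a = t, 1 / (a : ℝ)
        ≤ ∑ t ∈ Finset.Icc 1 N, 1 / (t : ℝ) ^ 2 * X := by
          refine Finset.sum_le_sum fun t ht => ?_
          have ht0 : t ≠ 0 := by have := Finset.mem_Icc.mp ht; omega
          have h1 : ∑ a ∈ A with rt a = t, 1 / (a : ℝ) =
              1 / (t : ℝ) ^ 2 * ∑ s ∈ (A.filter fun a => rt a = t).image sq, 1 / (s : ℝ) := by
            rw [Finset.sum_image, Finset.mul_sum]
            · refine Finset.sum_congr rfl fun a ha => ?_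
              rw [one_div_mul_one_div, ← (Finset.mem_filter.mp ha).2]
              exact_mod_cast congrArg (fun n : ℕ => 1 / (n : ℝ)) (hmul a).symm
            · intro a ha b hb hab
              have hab' : sq a = sq b := hab
              rw [← hmul a, ← hmul b, hab', (Finset.mem_filter.mp ha).2, (Finset.mem_filter.mp hb).2]
          rw [h1]
          refine mul_le_mul_of_nonneg_left (le_trans ?_ (hX t ht0)) (by positivity)
          refine Finset.sum_le_sum_of_subset_of_nonneg (fun s hs => ?_) fun _ _ _ => by positivity
          obtain ⟨a, ha, rfl⟩ := Finset.mem_image.mp hs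
          obtain ⟨haA, hat⟩ := Finset.mem_filter.mp ha
          have hm : sq a * t ^ 2 = a := by rw [← hat, mul_comm, hmul]
          refine Finset.mem_filter.mpr ⟨Finset.mem_Icc.mpr ⟨Nat.pos_of_ne_zero (hsq a).ne_zero, ?_⟩,
            hsq a, hm.symm ▸ haA⟩
          exact (Nat.le_of_dvd (hA' haA).1 (Dvd.intro _ hm)).trans (hA' haA).2
      _ ≤ 2 * X := by
          rw [← Finset.sum_mul]
          exact mul_le_mul_of_nonneg_right (sum_one_div_sq_le_two N) hX0
  · intro a ha
    refine Finset.mem_Icc.mpr ⟨Nat.pos_of_ne_zero (hrt ha), ?_⟩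
    refine (Nat.le_of_dvd (hA' ha).1 ?_).trans (hA' ha).2
    exact (dvd_pow_self _ two_ne_zero).trans (Dvd.intro _ (hmul a))

namespace EqualLCM

/-- Group the products `m = s * b`: for given `m`, each `s` dividing it determines `b`. -/
lemma sum_mul_harmonic_le {B : Finset ℕ} {N : ℕ} (hBN : B ⊆ Finset.Icc 1 N) :
    (∑ s ∈ B, 1 / (s : ℝ)) * ∑ b ∈ Finset.Icc 1 N, 1 / (b : ℝ) ≤
      ∑ m ∈ Finset.Icc 1 (N ^ 2), ((B.filter (· ∣ m)).card : ℝ) / m := by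
  have h1 : ∑ m ∈ Finset.Icc 1 (N ^ 2), ((B.filter (· ∣ m)).card : ℝ) / m =
      ∑ s ∈ B, ∑ m ∈ Finset.Icc 1 (N ^ 2) with s ∣ m, 1 / (m : ℝ) := by
    simp_rw [Finset.card_eq_sum_ones, Nat.cast_sum, Finset.sum_div, Finset.sum_filter]
    rw [Finset.sum_comm]
    refine Finset.sum_congr rfl fun s _ => Finset.sum_congr rfl fun m _ => ?_
    split_ifs <;> simp
  rw [h1, Finset.sum_mul]
  refine Finset.sum_le_sum fun s hs => ?_
  have hs' := Finset.mem_Icc.mp (hBN hs)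
  rw [Finset.mul_sum]
  calc ∑ b ∈ Finset.Icc 1 N, 1 / (s : ℝ) * (1 / (b : ℝ))
      = ∑ m ∈ (Finset.Icc 1 N).image (s * ·), 1 / (m : ℝ) := by
        rw [Finset.sum_image fun a _ b _ hab => Nat.eq_of_mul_eq_mul_left hs'.1 hab]
        refine Finset.sum_congr rfl fun b _ => ?_
        push_cast
        rw [one_div_mul_one_div]
    _ ≤ _ := by
        refine Finset.sum_le_sum_of_subset_of_nonneg (fun m hm => ?_) fun _ _ _ => by positivity
        obtain ⟨b, hb, rfl⟩ := Finset.mem_image.mp hm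
        have hb' := Finset.mem_Icc.mp hb
        refine Finset.mem_filter.mpr ⟨Finset.mem_Icc.mpr ⟨Nat.mul_pos hs'.1 hb'.1, ?_⟩,
          Dvd.intro _ rfl⟩
        rw [pow_two]
        exact Nat.mul_le_mul hs'.2 hb'.2

lemma exists_squarefree_sum_mul_log_le {D : ℝ} (hD : capacity < D) (hD2 : D ≤ 2) :
    ∃ K : ℝ, 0 < K ∧ ∀ (N : ℕ), 2 ≤ N → ∀ B ⊆ Finset.Icc 1 N, LCMFree 3 B →
      (∀ s ∈ B, Squarefree s) →
      (∑ s ∈ B, 1 / (s : ℝ)) * Real.log N ≤ K * (1 + 2 * Real.log N) ^ D := by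
  obtain ⟨K, hK0, hK⟩ := exists_linear_mul_capacity_pow_le hD
  refine ⟨K * Real.exp 1, by positivity, fun N hN B hBN hB hsq => ?_⟩
  have hD1 : 1 ≤ D := (one_lt_capacity.trans hD).le
  calc (∑ s ∈ B, 1 / (s : ℝ)) * Real.log N
      ≤ (∑ s ∈ B, 1 / (s : ℝ)) * ∑ b ∈ Finset.Icc 1 N, 1 / (b : ℝ) :=
        mul_le_mul_of_nonneg_left (log_le_sum_one_div N) (Finset.sum_nonneg fun _ _ => by positivity)
    _ ≤ ∑ m ∈ Finset.Icc 1 (N ^ 2), ((B.filter (· ∣ m)).card : ℝ) / m := sum_mul_harmonic_le hBN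
    _ ≤ ∑ m ∈ Finset.Icc 1 (N ^ 2), K * (D ^ m.primeFactors.card / m) := by
        refine Finset.sum_le_sum fun m hm => ?_
        have hm0 : m ≠ 0 := by have := Finset.mem_Icc.mp hm; omega
        rw [← mul_div_assoc]
        gcongr
        exact (card_divisors_le hB hsq hm0).trans (hK _)
    _ = K * ∑ m ∈ Finset.Icc 1 (N ^ 2), D ^ m.primeFactors.card / (m : ℝ) := by
        rw [Finset.mul_sum]
    _ ≤ K * (Real.exp 1 * (1 + Real.log ((N ^ 2 : ℕ) : ℝ)) ^ D) := by
        gcongr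
        exact sum_pow_card_primeFactors_div_le hD1 hD2 (by nlinarith)
    _ = _ := by
        rw [Nat.cast_pow, Real.log_pow]; push_cast; ring

lemma exists_f_three_le {D : ℝ} (hD : capacity < D) (hD2 : D ≤ 2) :
    ∃ K : ℝ, 0 < K ∧ ∀ N : ℕ, 3 ≤ N → f 3 N ≤ K * Real.log N ^ (D - 1) := by
  obtain ⟨K, hK0, hK⟩ := exists_squarefree_sum_mul_log_le hD hD2
  have hD1 : 1 < D := one_lt_capacity.trans hD
  refine ⟨2 * (K * 3 ^ D), by positivity, fun N hN => ?_⟩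
  have hlog : 1 ≤ Real.log N := by
    rw [Real.le_log_iff_exp_le (by positivity)]
    have : (3 : ℝ) ≤ N := by exact_mod_cast hN
    linarith [Real.exp_one_lt_d9]
  obtain ⟨A, hAN, hA, hf⟩ := (isGreatest_f (k := 3) (by norm_num) N).1
  rw [hf, mul_assoc]
  refine sum_one_div_le_of_squarefree_parts hAN (by positivity) fun t ht => ?_
  -- Multiplying by the common factor `t ^ 2` preserves equalities of lcms.
  have hfree : LCMFree 3 ((Finset.Icc 1 N).filter fun s => Squarefree s ∧ s * t ^ 2 ∈ A) := by
    rw [lcmFree_three_iff] at hA ⊢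
    intro a ha b hb c hc hab hac hbc ⟨h1, h2⟩
    simp only [Finset.mem_filter] at ha hb hc
    have ht2 : t ^ 2 ≠ 0 := pow_ne_zero 2 ht
    refine hA _ ha.2.2 _ hb.2.2 _ hc.2.2 (fun h => hab (Nat.eq_of_mul_eq_mul_right (by positivity) h))
      (fun h => hac (Nat.eq_of_mul_eq_mul_right (by positivity) h))
      (fun h => hbc (Nat.eq_of_mul_eq_mul_right (by positivity) h)) ?_
    simp only [Nat.lcm_mul_right, h1, ← h2, and_self]
  have h1 := hK N (by omega) _ (Finset.filter_subset _ _) hfree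
    (fun s hs => (Finset.mem_filter.mp hs).2.1)
  have h2 : (1 + 2 * Real.log N) ^ D ≤ 3 ^ D * (Real.log N ^ (D - 1) * Real.log N) := by
    rw [← Real.rpow_add_one (by positivity), sub_add_cancel,
      ← Real.mul_rpow (by norm_num) (by positivity)]
    refine Real.rpow_le_rpow (by positivity) (by linarith) (by linarith)
  refine le_of_mul_le_mul_right ?_ (zero_lt_one.trans_le hlog)
  calc _ ≤ _ := h1
    _ ≤ K * (3 ^ D * (Real.log N ^ (D - 1) * Real.log N)) := by gcongr
    _ = _ := by ring

lemma f_nonneg (N : ℕ) : 0 ≤ f 3 N := by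
  obtain ⟨A, -, -, hf⟩ := (isGreatest_f (k := 3) (by norm_num) N).1
  rw [hf]
  exact Finset.sum_nonneg fun _ _ => by positivity

lemma tendsto_log_log_atTop : Tendsto (fun N : ℕ => Real.log (Real.log N)) atTop atTop :=
  Real.tendsto_log_atTop.comp (Real.tendsto_log_atTop.comp tendsto_natCast_atTop_atTop)

theorem f_three_upper :
    ∃ ε : ℕ → ℝ, Tendsto ε atTop (𝓝 0) ∧
      (fun N : ℕ => f 3 N) =O[atTop] (fun N : ℕ => Real.log (N : ℝ) ^ (capacity - 1 + ε N)) := by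
  -- The least nonnegative correction for which the bound holds with constant 1 once log log N > 0.
  refine ⟨fun N => max 0 (Real.log (f 3 N) / Real.log (Real.log N) - (capacity - 1)), ?_, ?_⟩
  · rw [Metric.tendsto_nhds]
    intro η hη
    -- The cap keeps the base `capacity + δ` at most 2, as the mean value estimate requires.
    set δ : ℝ := min (η / 2) (2 - capacity) with hδ
    have hδ0 : 0 < δ := lt_min (by linarith) (by linarith [capacity_lt_two])
    have hδη : δ ≤ η / 2 := min_le_left _ _
    have hδ2 : δ ≤ 2 - capacity := min_le_right _ _
    obtain ⟨K, hK0, hK⟩ := exists_f_three_le (D := capacity + δ) (by linarith) (by linarith)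
    filter_upwards [eventually_ge_atTop 3, tendsto_log_log_atTop.eventually_gt_atTop 0,
      tendsto_log_log_atTop.eventually_gt_atTop (2 * Real.log K / η)] with N hN3 hL0 hLK
    rw [Real.dist_eq, sub_zero, abs_of_nonneg (le_max_left _ _), max_lt_iff]
    refine ⟨hη, ?_⟩
    rw [sub_lt_iff_lt_add, div_lt_iff₀ hL0]
    have hlog : 0 < Real.log N := Real.log_pos (by exact_mod_cast (by omega : 1 < N))
    rw [div_lt_iff₀ hη] at hLK
    rcases (f_nonneg N).eq_or_lt with h0 | hpos
    · rw [← h0, Real.log_zero]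
      have := one_lt_capacity
      exact mul_pos (by linarith) hL0
    · have h1 := Real.log_le_log hpos (hK N hN3)
      rw [Real.log_mul hK0.ne' (by positivity), Real.log_rpow hlog] at h1
      have h2 : δ * Real.log (Real.log N) ≤ η / 2 * Real.log (Real.log N) := by gcongr
      linarith
  · refine IsBigO.of_bound 1 ?_
    filter_upwards [eventually_ge_atTop 3, tendsto_log_log_atTop.eventually_gt_atTop 0] with N hN3 hL0
    have hlog : 0 < Real.log N := Real.log_pos (by exact_mod_cast (by omega : 1 < N))
    rw [Real.norm_of_nonneg (f_nonneg N), Real.norm_of_nonneg (by positivity), one_mul]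
    rcases (f_nonneg N).eq_or_lt with h0 | hpos
    · rw [← h0]; positivity
    · rw [← Real.log_le_log_iff hpos (by positivity), Real.log_rpow hlog, ← div_le_iff₀ hL0]
      linarith [le_max_right 0 (Real.log (f 3 N) / Real.log (Real.log N) - (capacity - 1))]

end EqualLCM

/-! ### Random parity hashing. -/

lemma AddMonoidHom.card_filter_eq_zero_mul {G H : Type*} [AddGroup G] [AddGroup H] [Fintype G]
    [Fintype H] [DecidableEq H] (φ : G →+ H) (hφ : Function.Surjective φ) :
    (Finset.univ.filter fun g => φ g = 0).card * Fintype.card H = Fintype.card G := by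
  have h1 := Finset.card_eq_sum_card_fiberwise (s := (Finset.univ : Finset G)) (f := φ)
    (t := Finset.univ) (by simp)
  rw [Finset.card_univ, Finset.sum_congr rfl fun h _ =>
    AddMonoidHom.card_fiber_eq_of_mem_range φ (hφ h) (hφ 0)] at h1
  rw [h1, Finset.sum_const, Finset.card_univ, smul_eq_mul, mul_comm]

lemma AddMonoidHom.card_filter_forall_eq_zero_mul {G H : Type*} [AddGroup G] [AddGroup H]
    [Fintype G] [Fintype H] [DecidableEq H] (ψ : G →+ H) (hψ : Function.Surjective ψ)
    {r R : ℕ} (hr : r ≤ R) :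
    (Finset.univ.filter fun ω : Fin R → G => ∀ j : Fin R, j.val < r → ψ (ω j) = 0).card *
      Fintype.card H ^ r = Fintype.card (Fin R → G) := by
  classical
  let Ψ : (Fin R → G) →+ (Fin r → H) :=
    { toFun := fun ω i => ψ (ω (Fin.castLE hr i))
      map_zero' := by ext; simp
      map_add' := fun a b => by ext; simp }
  have hΨ : Function.Surjective Ψ := fun y => by
    choose s hs using hψ
    refine ⟨fun j => if h : j.val < r then s (y ⟨j.val, h⟩) else 0, ?_⟩
    ext i
    simp [Ψ, hs]
  have h := Ψ.card_filter_eq_zero_mul hΨ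
  rw [Fintype.card_fun, Fintype.card_fin] at h
  rw [← h]
  congr 2
  ext ω
  simp only [Finset.mem_filter, Finset.mem_univ, true_and]
  constructor
  · intro hω; ext i; exact hω _ i.2
  · intro hω j hj; exact congrFun hω ⟨j.val, hj⟩

section
variable {ι : Type*}

/-- The parity of `u` on `A`. -/
def parityHom (A : Finset ι) : (ι → ZMod 2) × ZMod 2 →+ ZMod 2 where
  toFun v := ∑ i ∈ A, v.1 i
  map_zero' := by simp
  map_add' v w := by simp [Finset.sum_add_distrib]

/-- The affine parity of `(u, b)` on `A`. -/
def affineParityHom (A : Finset ι) : (ι → ZMod 2) × ZMod 2 →+ ZMod 2 where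
  toFun v := ∑ i ∈ A, v.1 i + v.2
  map_zero' := by simp
  map_add' v w := by simp [Finset.sum_add_distrib]; ring

lemma affineParityHom_surjective (A : Finset ι) : Function.Surjective (affineParityHom A) :=
  fun b => ⟨(0, b), by simp [affineParityHom]⟩

lemma affineParityHom_prod_parityHom_surjective [DecidableEq ι] {A D : Finset ι} (hD : D ⊆ A) (hne : D.Nonempty) :
    Function.Surjective ((affineParityHom A).prod (parityHom D)) := by
  obtain ⟨x, hx⟩ := hne
  rintro ⟨a, b⟩
  refine ⟨(Pi.single x b, a - b), ?_⟩
  simp [affineParityHom, parityHom, hx, hD hx]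

/-- The first `#A + 1` random affine parities vanish on `A`, and the corresponding linear parities
separate the nonempty subsets of `A` from the empty set. -/
def HashesToZero {R : ℕ} (ω : Fin R → (ι → ZMod 2) × ZMod 2) (A : Finset ι) : Prop :=
  (∀ j : Fin R, j.val < A.card + 1 → affineParityHom A (ω j) = 0) ∧
    ∀ D ⊆ A, D.Nonempty → ∃ j : Fin R, j.val < A.card + 1 ∧ parityHom D (ω j) ≠ 0

/-- Equal unions force `symmDiff B C ⊆ A`. Since `B` and `C` are at least as large as `A`, they pass
every test used for `A`; adding their vanishing affine parities cancels the shift and kills the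
parity of `symmDiff B C`, so `A` separates it from ∅ only if it is empty. -/
lemma eq_of_union_eq_of_hashesToZero [DecidableEq ι] {R : ℕ} {ω : Fin R → (ι → ZMod 2) × ZMod 2} {A B C : Finset ι}
    (hA : HashesToZero ω A) (hB : HashesToZero ω B) (hC : HashesToZero ω C)
    (h : A ∪ B = A ∪ C) (hAB : A.card ≤ B.card) (hAC : A.card ≤ C.card) : B = C := by
  by_contra hne
  have hD : symmDiff B C ⊆ A := by
    intro x hx
    have : x ∈ A ∪ B ↔ x ∈ A ∪ C := by rw [h]
    rw [Finset.mem_symmDiff] at hx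
    simp only [Finset.mem_union] at this
    tauto
  obtain ⟨j, hj, hj0⟩ := hA.2 _ hD (Finset.nonempty_iff_ne_empty.mpr
    fun h0 => hne (symmDiff_eq_bot.mp h0))
  have hb := hB.1 j (by omega)
  have hc := hC.1 j (by omega)
  apply hj0
  change ∑ i ∈ B, (ω j).1 i + (ω j).2 = 0 at hb
  change ∑ i ∈ C, (ω j).1 i + (ω j).2 = 0 at hc
  change ∑ i ∈ symmDiff B C, (ω j).1 i = 0
  have h1 : symmDiff B C = (B \ C) ∪ (C \ B) := rfl
  rw [h1, Finset.sum_union (Finset.disjoint_of_subset_right Finset.sdiff_subset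
    Finset.sdiff_disjoint)]
  have h2 := Finset.sum_inter_add_sum_sdiff B C (fun i => (ω j).1 i)
  have h3 := Finset.sum_inter_add_sum_sdiff C B (fun i => (ω j).1 i)
  rw [Finset.inter_comm] at h3
  have h4 : ∀ x : ZMod 2, x + x = 0 := CharTwo.add_self_eq_zero
  linear_combination hb + hc + h2 + h3 - h4 (ω j).2 - h4 (∑ i ∈ B ∩ C, (ω j).1 i)

open Classical in
-- With `s = #A`, all affine parities vanish with probability 2^(-s-1). For each of at most 2^s
-- nonempty `D`, its parities also vanish with probability 4^(-s-1). The union bound removes at most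
-- 2^(-s-2), half of the first probability.
lemma card_le_card_hashesToZero_mul [Fintype ι] [DecidableEq ι] {R : ℕ} (A : Finset ι) (hR : A.card + 1 ≤ R) :
    Fintype.card (Fin R → (ι → ZMod 2) × ZMod 2) ≤
      (Finset.univ.filter fun ω : Fin R → (ι → ZMod 2) × ZMod 2 => HashesToZero ω A).card *
        2 ^ (A.card + 2) := by
  set s := A.card
  set n := Fintype.card (Fin R → (ι → ZMod 2) × ZMod 2)
  let Z : Finset (Fin R → (ι → ZMod 2) × ZMod 2) :=
    Finset.univ.filter fun ω => ∀ j : Fin R, j.val < s + 1 → affineParityHom A (ω j) = 0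
  let E : Finset ι → Finset (Fin R → (ι → ZMod 2) × ZMod 2) := fun D =>
    Finset.univ.filter fun ω => ∀ j : Fin R, j.val < s + 1 →
      ((affineParityHom A).prod (parityHom D)) (ω j) = 0
  let P : Finset (Finset ι) := A.powerset.filter (·.Nonempty)
  have hZ : Z.card * 2 ^ (s + 1) = n := by
    have := (affineParityHom A).card_filter_forall_eq_zero_mul (affineParityHom_surjective A) hR
    rwa [ZMod.card] at this
  have hE : ∀ D ∈ P, (E D).card * 4 ^ (s + 1) = n := fun D hD => by
    obtain ⟨h1, h2⟩ := Finset.mem_filter.mp hD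
    have := AddMonoidHom.card_filter_forall_eq_zero_mul _
      (affineParityHom_prod_parityHom_surjective (Finset.mem_powerset.mp h1) h2) hR
    rwa [Fintype.card_prod, ZMod.card] at this
  have hcover : Z ⊆ (Finset.univ.filter fun ω => HashesToZero ω A) ∪ P.biUnion E := by
    intro ω hω
    rw [Finset.mem_union]
    by_contra! hc
    obtain ⟨h1, h2⟩ := hc
    apply h1
    have hω' : ∀ j : Fin R, j.val < s + 1 → affineParityHom A (ω j) = 0 := by simpa [Z] using hω
    refine Finset.mem_filter.mpr ⟨Finset.mem_univ _, hω', fun D hD hne => ?_⟩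
    by_contra! hc
    refine h2 (Finset.mem_biUnion.mpr ⟨D, Finset.mem_filter.mpr ⟨Finset.mem_powerset.mpr hD, hne⟩,
      Finset.mem_filter.mpr ⟨Finset.mem_univ _, fun j hj => ?_⟩⟩)
    exact Prod.ext (hω' j hj) (hc j hj)
  have hP : P.card ≤ 2 ^ s := (Finset.card_filter_le _ _).trans (Finset.card_powerset A).le
  have hU : (P.biUnion E).card * 4 ^ (s + 1) ≤ 2 ^ s * n := by
    calc (P.biUnion E).card * 4 ^ (s + 1) ≤ (∑ D ∈ P, (E D).card) * 4 ^ (s + 1) :=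
          Nat.mul_le_mul_right _ Finset.card_biUnion_le
      _ = P.card * n := by rw [Finset.sum_mul, Finset.sum_congr rfl hE, Finset.sum_const, smul_eq_mul]
      _ ≤ _ := Nat.mul_le_mul_right _ hP
  have hle := (Finset.card_le_card hcover).trans (Finset.card_union_le _ _)
  have h4 : (4 : ℕ) ^ (s + 1) = 2 ^ s * 2 ^ (s + 2) := by
    rw [show (4 : ℕ) = 2 ^ 2 by norm_num, ← pow_mul, ← pow_add]; ring_nf
  have hU' : (P.biUnion E).card * 2 ^ (s + 2) ≤ n := by
    refine Nat.le_of_mul_le_mul_left ?_ (pow_pos two_pos s : 0 < 2 ^ s)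
    calc _ = (P.biUnion E).card * 4 ^ (s + 1) := by rw [h4]; ring
      _ ≤ _ := hU
  have h5 := Nat.mul_le_mul_right (2 ^ (s + 2)) hle
  have h6 : Z.card * 2 ^ (s + 2) = 2 * n := by rw [← hZ]; ring
  rw [add_mul, h6] at h5
  omega

end

/-! ### The weighted squarefree sum has order at least the square root of log N. -/

lemma Nat.card_divisors_of_squarefree {m : ℕ} (hm : Squarefree m) :
    m.divisors.card = 2 ^ m.primeFactors.card := by
  rw [Nat.card_divisors hm.ne_zero, ← Finset.prod_const]
  refine Finset.prod_congr rfl fun p hp => ?_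
  have h1 := hm.natFactorization_le_one p
  have h2 := (Nat.prime_of_mem_primeFactors hp).factorization_pos_of_dvd hm.ne_zero
    (Nat.dvd_of_mem_primeFactors hp)
  omega

/-- A squarefree `m` has 2^ω(m) ordered factorizations, each contributing 2^(-ω(m))/m to the
expanded square. -/
lemma sum_squarefree_le_sq (N : ℕ) :
    ∑ m ∈ Finset.Icc 1 N with Squarefree m, 1 / (m : ℝ) ≤
      (∑ a ∈ Finset.Icc 1 N with Squarefree a, (1 / 2 : ℝ) ^ a.primeFactors.card / a) ^ 2 := by
  set Q := (Finset.Icc 1 N).filter Squarefree with hQ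
  let g : ℕ → ℝ := fun a => (1 / 2 : ℝ) ^ a.primeFactors.card / a
  have hg : ∀ a, 0 ≤ g a := fun a => by positivity
  have hdiv : ∀ m ∈ Q, 1 / (m : ℝ) = ∑ x ∈ m.divisorsAntidiagonal, g x.1 * g x.2 := by
    intro m hm
    have hsq : Squarefree m := (Finset.mem_filter.mp hm).2
    have hconst : ∀ x ∈ m.divisorsAntidiagonal,
        g x.1 * g x.2 = (1 / 2 : ℝ) ^ m.primeFactors.card / m := by
      rintro ⟨a, b⟩ hx
      obtain ⟨hab, -⟩ := Nat.mem_divisorsAntidiagonal.mp hx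
      have hab' : a * b = m := hab
      have hcop : Nat.Coprime a b := Nat.coprime_of_squarefree_mul (hab' ▸ hsq)
      simp only [g]
      rw [← hab', hcop.primeFactors_mul, Finset.card_union_of_disjoint hcop.disjoint_primeFactors,
        pow_add, Nat.cast_mul, div_mul_div_comm]
    have hcard : m.divisorsAntidiagonal.card = m.divisors.card := by
      rw [← Nat.map_div_right_divisors, Finset.card_map]
    rw [Finset.sum_congr rfl hconst, Finset.sum_const, hcard, Nat.card_divisors_of_squarefree hsq,
      nsmul_eq_mul, Nat.cast_pow, ← mul_div_assoc, Nat.cast_ofNat, ← mul_pow]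
    norm_num
  have hfilter : ∀ m ∈ Q, m.divisorsAntidiagonal ⊆ (Q ×ˢ Q).filter fun x => x.1 * x.2 = m := by
    rintro m hm ⟨a, b⟩ hx
    obtain ⟨hab, hm0⟩ := Nat.mem_divisorsAntidiagonal.mp hx
    have hab' : a * b = m := hab
    obtain ⟨hmN, hsq⟩ := Finset.mem_filter.mp hm
    have hmN' := Finset.mem_Icc.mp hmN
    have hmem : ∀ d, d ∣ m → d ∈ Q := fun d hd => by
      refine Finset.mem_filter.mpr ⟨Finset.mem_Icc.mpr ⟨Nat.pos_of_dvd_of_pos hd hmN'.1,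
        (Nat.le_of_dvd hmN'.1 hd).trans hmN'.2⟩, hsq.squarefree_of_dvd hd⟩
    exact Finset.mem_filter.mpr ⟨Finset.mem_product.mpr ⟨hmem a (Dvd.intro _ hab'),
      hmem b (Dvd.intro_left _ hab')⟩, hab'⟩
  have hpos : ∀ x : ℕ × ℕ, 0 ≤ g x.1 * g x.2 := fun x => mul_nonneg (hg _) (hg _)
  calc ∑ m ∈ Q, 1 / (m : ℝ) = ∑ m ∈ Q, ∑ x ∈ m.divisorsAntidiagonal, g x.1 * g x.2 :=
        Finset.sum_congr rfl hdiv
    _ ≤ ∑ m ∈ Q, ∑ x ∈ (Q ×ˢ Q) with x.1 * x.2 = m, g x.1 * g x.2 :=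
        Finset.sum_le_sum fun m hm =>
          Finset.sum_le_sum_of_subset_of_nonneg (hfilter m hm) fun x _ _ => hpos x
    _ ≤ ∑ x ∈ Q ×ˢ Q, g x.1 * g x.2 := by
        rw [Finset.sum_fiberwise_eq_sum_filter]
        exact Finset.sum_le_sum_of_subset_of_nonneg (Finset.filter_subset _ _) fun x _ _ => hpos x
    _ = (∑ a ∈ Q, g a) ^ 2 := by
        rw [Finset.sum_product, pow_two, Finset.sum_mul_sum]

lemma log_le_two_mul_sum_sq (N : ℕ) :
    Real.log N ≤
      2 * (∑ a ∈ Finset.Icc 1 N with Squarefree a, (1 / 2 : ℝ) ^ a.primeFactors.card / a) ^ 2 := by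
  refine (log_le_sum_one_div N).trans
    ((sum_one_div_le_of_squarefree_parts (N := N) subset_rfl (sq_nonneg _) fun t ht => ?_))
  refine le_trans (Finset.sum_le_sum_of_subset_of_nonneg (fun s hs => ?_)
    fun _ _ _ => by positivity) (sum_squarefree_le_sq N)
  obtain ⟨h1, h2, -⟩ := Finset.mem_filter.mp hs
  exact Finset.mem_filter.mpr ⟨h1, h2⟩

/-! ### The lower bound. -/

namespace EqualLCM

/-- The prime factors of `a` lying below `N + 1`. -/
def primeSupport (N a : ℕ) : Finset (Finset.range (N + 1)) :=
  a.primeFactors.subtype (· ∈ Finset.range (N + 1))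

lemma map_primeSupport {N a : ℕ} (ha : a ∈ Finset.Icc 1 N) :
    (primeSupport N a).map (Function.Embedding.subtype _) = a.primeFactors := by
  refine Finset.subtype_map_of_mem fun p hp => ?_
  have h1 := Finset.mem_Icc.mp ha
  have h2 := Nat.le_of_mem_primeFactors hp
  exact Finset.mem_range.mpr (by omega)

lemma card_primeSupport {N a : ℕ} (ha : a ∈ Finset.Icc 1 N) :
    (primeSupport N a).card = a.primeFactors.card := by
  rw [← map_primeSupport ha, Finset.card_map]

open Classical in
/-- The squarefree `a ≤ N` whose set of prime factors hashes to zero. -/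
noncomputable def hashedSet (N : ℕ) {R : ℕ}
    (ω : Fin R → (Finset.range (N + 1) → ZMod 2) × ZMod 2) : Finset ℕ :=
  (Finset.Icc 1 N).filter fun a => Squarefree a ∧ HashesToZero ω (primeSupport N a)

lemma primeSupport_union_eq {N a b c d : ℕ}
    (h : Nat.lcm a b = Nat.lcm c d) (ha : a ≠ 0) (hb : b ≠ 0) (hc : c ≠ 0) (hd : d ≠ 0) :
    primeSupport N a ∪ primeSupport N b = primeSupport N c ∪ primeSupport N d := by
  have key : ∀ {a b p : ℕ}, a ≠ 0 → b ≠ 0 → ((p.Prime ∧ p ∣ a ∧ a ≠ 0) ∨ (p.Prime ∧ p ∣ b ∧ b ≠ 0) ↔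
      p.Prime ∧ p ∣ Nat.lcm a b) := by
    intro a b p ha hb
    constructor
    · rintro (⟨hp, h, -⟩ | ⟨hp, h, -⟩)
      · exact ⟨hp, h.trans (Nat.dvd_lcm_left a b)⟩
      · exact ⟨hp, h.trans (Nat.dvd_lcm_right a b)⟩
    · rintro ⟨hp, h⟩
      rcases hp.dvd_mul.mp (h.trans (Nat.lcm_dvd_mul a b)) with h | h
      · exact Or.inl ⟨hp, h, ha⟩
      · exact Or.inr ⟨hp, h, hb⟩
  ext p
  simp only [primeSupport, Finset.mem_union, Finset.mem_subtype, Nat.mem_primeFactors]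
  rw [key ha hb, key hc hd, h]

lemma hashedSet_lcmFree (N : ℕ) {R : ℕ} (ω : Fin R → (Finset.range (N + 1) → ZMod 2) × ZMod 2) :
    LCMFree 3 (hashedSet N ω) := by
  classical
  rw [lcmFree_three_iff]
  have hmem : ∀ {a}, a ∈ hashedSet N ω → a ∈ Finset.Icc 1 N ∧ Squarefree a ∧
      HashesToZero ω (primeSupport N a) := fun ha => by simpa [hashedSet, and_assoc] using ha
  have key : ∀ {a b c}, a ∈ hashedSet N ω → b ∈ hashedSet N ω → c ∈ hashedSet N ω →
      Nat.lcm a b = Nat.lcm a c → a.primeFactors.card ≤ b.primeFactors.card →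
      a.primeFactors.card ≤ c.primeFactors.card → b = c := by
    intro a b c ha hb hc h hab hac
    obtain ⟨ha1, ha2, ha3⟩ := hmem ha
    obtain ⟨hb1, hb2, hb3⟩ := hmem hb
    obtain ⟨hc1, hc2, hc3⟩ := hmem hc
    refine Nat.eq_of_primeFactors_eq hb2 hc2 ?_
    rw [← map_primeSupport hb1, ← map_primeSupport hc1]
    rw [eq_of_union_eq_of_hashesToZero ha3 hb3 hc3 (primeSupport_union_eq h ha2.ne_zero hb2.ne_zero
      ha2.ne_zero hc2.ne_zero) (by rwa [card_primeSupport ha1, card_primeSupport hb1])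
      (by rwa [card_primeSupport ha1, card_primeSupport hc1])]
  -- The element with the fewest prime factors plays the role of `A` in the hashing argument and
  -- forces the other two to coincide.
  rintro a ha b hb c hc hab hac hbc ⟨h1, h2⟩
  rcases le_total a.primeFactors.card b.primeFactors.card with hAB | hAB
  · rcases le_total a.primeFactors.card c.primeFactors.card with hAC | hAC
    · exact hbc (key ha hb hc h1 hAB hAC)
    · exact hab (key hc ha hb (by rw [Nat.lcm_comm c a, Nat.lcm_comm c b, ← h1, h2]) hAC
        (hAC.trans hAB))
  · rcases le_total b.primeFactors.card c.primeFactors.card with hBC | hBC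
    · exact hac (key hb ha hc (by rw [Nat.lcm_comm b a, h2]) hAB hBC)
    · exact hab (key hc ha hb (by rw [Nat.lcm_comm c a, Nat.lcm_comm c b, ← h1, h2])
        (hBC.trans hAB) hBC)

/-- First moment: average the harmonic sum of `hashedSet N ω` over all `ω`. -/
lemma quarter_mul_sum_le_f (N : ℕ) :
    1 / 4 * ∑ a ∈ Finset.Icc 1 N with Squarefree a, (1 / 2 : ℝ) ^ a.primeFactors.card / a ≤
      f 3 N := by
  classical
  set Q := (Finset.Icc 1 N).filter Squarefree with hQ
  -- A subset of the `N + 1` points needs at most `N + 2` tests.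
  let Ω := Fin (N + 2) → (Finset.range (N + 1) → ZMod 2) × ZMod 2
  have hΩ : (0 : ℝ) < Fintype.card Ω := by exact_mod_cast Fintype.card_pos
  have hω : ∀ ω : Ω, ∑ a ∈ hashedSet N ω, 1 / (a : ℝ) ≤ f 3 N := fun ω =>
    (isGreatest_f (k := 3) (by norm_num) N).2
      ⟨_, Finset.filter_subset _ _, hashedSet_lcmFree N ω, rfl⟩
  have hcount : ∀ a ∈ Q, (Fintype.card Ω : ℝ) * (1 / 4 * (1 / 2) ^ a.primeFactors.card) ≤
      ((Finset.univ.filter fun ω : Ω => HashesToZero ω (primeSupport N a)).card : ℝ) := by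
    intro a ha
    have ha1 := (Finset.mem_filter.mp ha).1
    have hR : (primeSupport N a).card + 1 ≤ N + 2 := by
      have := Finset.card_le_univ (primeSupport N a)
      rw [Fintype.card_coe, Finset.card_range] at this
      omega
    have h1 : (Fintype.card Ω : ℝ) ≤ _ := Nat.cast_le.mpr
      (card_le_card_hashesToZero_mul (primeSupport N a) hR)
    rw [card_primeSupport ha1] at h1
    push_cast at h1
    calc _ ≤ _ * (1 / 4 * (1 / 2) ^ a.primeFactors.card) :=
          mul_le_mul_of_nonneg_right h1 (by positivity)
      _ = _ := by rw [pow_add, one_div_pow]; field_simp; ring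
  have hsum : ∑ ω : Ω, ∑ a ∈ hashedSet N ω, 1 / (a : ℝ) =
      ∑ a ∈ Q, ((Finset.univ.filter fun ω : Ω => HashesToZero ω (primeSupport N a)).card : ℝ) *
        (1 / (a : ℝ)) := by
    have h1 : ∀ ω : Ω, hashedSet N ω = Q.filter fun a => HashesToZero ω (primeSupport N a) :=
      fun ω => by rw [hQ, Finset.filter_filter]; rfl
    simp only [h1, Finset.sum_filter (s := Q)]
    rw [Finset.sum_comm]
    refine Finset.sum_congr rfl fun a _ => ?_
    rw [← Finset.sum_filter, Finset.sum_const, nsmul_eq_mul]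
  refine le_of_mul_le_mul_left ?_ hΩ
  calc (Fintype.card Ω : ℝ) * (1 / 4 * ∑ a ∈ Q, (1 / 2 : ℝ) ^ a.primeFactors.card / a)
      = ∑ a ∈ Q, (Fintype.card Ω : ℝ) * (1 / 4 * (1 / 2) ^ a.primeFactors.card) * (1 / (a : ℝ)) := by
        rw [Finset.mul_sum, Finset.mul_sum]
        exact Finset.sum_congr rfl fun a _ => by ring
    _ ≤ _ := Finset.sum_le_sum fun a ha => mul_le_mul_of_nonneg_right (hcount a ha) (by positivity)
    _ = ∑ ω : Ω, ∑ a ∈ hashedSet N ω, 1 / (a : ℝ) := hsum.symm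
    _ ≤ ∑ _ω : Ω, f 3 N := Finset.sum_le_sum fun ω _ => hω ω
    _ = _ := by rw [Finset.sum_const, Finset.card_univ, nsmul_eq_mul]

theorem log_le_mul_f_sq (N : ℕ) : Real.log N ≤ 32 * f 3 N ^ 2 := by
  have h1 := log_le_two_mul_sum_sq N
  have h2 := quarter_mul_sum_le_f N
  set G := ∑ a ∈ Finset.Icc 1 N with Squarefree a, (1 / 2 : ℝ) ^ a.primeFactors.card / a
  have hG : 0 ≤ G := Finset.sum_nonneg fun a _ => by positivity
  nlinarith

lemma log_lt_half : Real.log 1.551 < 1 / 2 := by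
  rw [Real.log_lt_iff_lt_exp (by norm_num)]
  have h : Real.exp (1 / 2) ^ 2 = Real.exp 1 := by rw [← Real.exp_nat_mul]; norm_num
  refine lt_of_pow_lt_pow_left₀ 2 (Real.exp_pos _).le ?_
  rw [h]
  exact lt_trans (by norm_num) Real.exp_one_gt_d9

theorem f_three_lower :
    ∀ᶠ N : ℕ in atTop, Real.log (N : ℝ) ^ Real.log (1.551 : ℝ) ≤ f 3 N := by
  have hd : 0 < 1 - 2 * Real.log 1.551 := by linarith [log_lt_half]
  have hlim : Tendsto (fun N : ℕ => Real.log (N : ℝ) ^ (1 - 2 * Real.log 1.551)) atTop atTop :=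
    (tendsto_rpow_atTop hd).comp (Real.tendsto_log_atTop.comp tendsto_natCast_atTop_atTop)
  filter_upwards [hlim.eventually_ge_atTop 32, eventually_ge_atTop 3] with N h32 hN3
  have hlog : 0 < Real.log N := Real.log_pos (by exact_mod_cast (by omega : 1 < N))
  refine le_of_sq_le_sq ?_ (f_nonneg N)
  have h1 : (Real.log N ^ Real.log (1.551 : ℝ)) ^ 2 * Real.log N ^ (1 - 2 * Real.log 1.551) =
      Real.log N := by
    rw [← Real.rpow_natCast, ← Real.rpow_mul hlog.le, ← Real.rpow_add hlog]
    norm_num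
    ring_nf
    exact Real.rpow_one _
  have h2 := mul_le_mul_of_nonneg_left h32 (sq_nonneg (Real.log N ^ Real.log (1.551 : ℝ)))
  have h3 := log_le_mul_f_sq N
  linarith

end EqualLCM

theorem mainTheorem5 :
    (∃ ε : ℕ → ℝ, Tendsto ε atTop (𝓝 0) ∧
      ∀ᶠ N : ℕ in atTop,
        Real.log (N : ℝ) ^ (Real.log (1.551 : ℝ) - ε N) ≤ EqualLCM.f 3 N) ∧
    (∃ ε : ℕ → ℝ, Tendsto ε atTop (𝓝 0) ∧
      (fun N : ℕ => EqualLCM.f 3 N) =O[atTop]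
        (fun N : ℕ => Real.log (N : ℝ) ^ (3 / (2 : ℝ) ^ ((2 : ℝ) / 3) - 1 + ε N))) :=
  ⟨⟨fun _ => 0, tendsto_const_nhds, by simpa only [sub_zero] using EqualLCM.f_three_lower⟩,
    EqualLCM.f_three_upper⟩
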